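/- Let $p\ge 3$ be a prime and let $S$ be a discrete valuation ring of residue characteristic $p$, with field of fractions $K$ and maximal ideal generated by $s$. Let $T|S$ and $T'|S$ be finite purely ramified extensions of discrete valuation rings, with fields of fractions $L$ and $L'$, such that $L|K$ and $L'|K$ are Galois with Galois group cyclic of order $p$. (Purely ramified means that the ramification index equals the degree: $sT=t^{p}T$ for a generator $t$ of the maximal ideal of $T$, and likewise for $T'$.) Suppose that the residue field of $S$ is perfect, or that there are generators $t$ of the maximal ideal of $T$ and $t'$ of the maximal ideal of $T'$ with $\mathrm{N}_{L|K}(t)=\mathrm{N}_{L'|K}(t')$. Let $\Delta_{T|S}=\mathrm{N}_{L|K}(\mathfrak{D}_{T|S})\subseteq S$ denote the discriminant ideal, i.e. the norm of the different ideal $\mathfrak{D}_{T|S}$, and similarly $\Delta_{T'|S}$. Suppose that \[ \mathrm{val}_s(\Delta_{T|S}) \;=\; \mathrm{val}_s(\Delta_{T'|S}) \;\le\; p\,\mathrm{val}_s(p)+p-1\, , \] where $\mathrm{val}_s(p)=+\infty$ if $p=0$ in $S$. Then \[ T\wr C_p \;\cong\; T'\wr C_p \] as $S$-algebras. Here $T\wr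 C_p$ is the twisted group ring: the free left $T$-module on $C_p=\mathrm{Gal}(L|K)$, which acts on $T$, with multiplication $(y\rho)(z\tau)=(y\,\rho(z))(\rho\tau)$ for $y,z\in T$ and $\rho,\tau\in C_p$; and $T'\wr C_p$ is defined in the same way with $C_p=\mathrm{Gal}(L'|K)$. -/

import Mathlib

open IsLocalRing

namespace PurelyRamified

section Extension

variable (p : ℕ) (S T : Type*) [CommRing S] [IsDomain S] [IsDiscreteValuationRing S]
  [CommRing T] [IsDomain T] [IsDiscreteValuationRing T]
  [Algebra S T] [Module.Finite S T] [FaithfulSMul S T]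

attribute [local instance] FractionRing.liftAlgebra in
/-- A finite extension `T | S` of discrete valuation rings is a purely ramified galois extension
with galois group `C_p`. Here `K = FractionRing S` and `L = FractionRing T`, and the inclusion of
`K` in `L` is the one that extends `S → T`. -/
structure IsPurelyRamifiedCyclic : Prop where
  /-- `S s = T t ^ [L : K]`: the ramification index is the degree (`T` is free over `S`,
  of rank `[L : K]`). -/
  map_maximalIdeal :
    (maximalIdeal S).map (algebraMap S T) = maximalIdeal T ^ Module.finrank S T
  /-- `L | K` is galois. -/
  isGalois : IsGalois (FractionRing S) (FractionRing T)
  /-- The galois group of `L | K` is cyclic of order `p`. -/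
  gal_equiv :
    Nonempty ((FractionRing T ≃ₐ[FractionRing S] FractionRing T) ≃* Multiplicative (ZMod p))

/-- The discriminant ideal `Δ_{T|S} ⊆ S`: the norm of the different ideal of `T | S`. -/
noncomputable def discriminant : Ideal S :=
  Ideal.relNorm S (differentIdeal S T)

/-- The valuation `val_s(Δ_{T|S})`, i.e. the largest `n` with `Δ_{T|S} ⊆ S s ^ n`. -/
noncomputable def discriminantVal : ℕ∞ :=
  emultiplicity (maximalIdeal S) (discriminant S T)

end Extension

/-- The twisted group ring `T ≀ G` of `T | S` with its galois group `G`. It is the free left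
`T`-module on `G`, with the multiplication `(y ρ) (z τ) = (y * ρ z) (ρ τ)`, and it is an algebra
over `S`. The group `G` is the group of `S`-algebra automorphisms of `T`; for a finite extension of
discrete valuation rings it is `Gal(L | K)` by restriction to the integral closure `T` of `S` in
`L`. -/
abbrev TwistedGroupRing (S T : Type*) [CommRing S] [CommRing T] [Algebra S T] :=
  SkewMonoidAlgebra T (T ≃ₐ[S] T)

end PurelyRamified

open IsDiscreteValuationRing hiding maximalIdeal

set_option linter.unusedSectionVars false

/-! ### Valuations and the basis given by the orbit of 1 under the shift. -/

namespace PurelyRamified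

section Valuation

variable {R : Type*} [CommRing R] [IsDomain R] [IsDiscreteValuationRing R]

/-! Let `σ` generate the group, `t` be a uniformizer of `T`, and `m` be the break, so that `σ t - t`
has valuation `m + 1`. By Dedekind's independence of automorphisms, the twisted group ring embeds in
`Module.End S T`. The idea is to describe its image so uniformly that it can be transported to `T'`.

Use the shift `z ↦ t * σ z`. The orbit of 1 under it has valuations `0, ..., p - 1`, hence is an
`S`-basis of `T`, and its `p`-th power is multiplication by the norm of `t`. Write the value of an
endomorphism at the `j`-th basis vector as the `j`-th shift of some `z j`. The endomorphism lies in
the image iff the `i`-th difference of `z` at 0 has valuation at least `i * m` for all `i < p`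
(`hasTies_of_mem_range`, `mem_range_of_hasTies`).

The linear map `T → T'` matching the two bases preserves valuations and commutes with the shifts
except at the last basis vector, where the defect is the difference of the norms of `t` and `t'`. If
these norms agree modulo `s ^ (m + 1)`, the defect is too small to affect the conditions, so
conjugation identifies the two images (`HasBreak.nonempty_algEquiv`).

The discriminant has valuation `(p - 1) * (m + 1)`, so both extensions have the same break. With
equal norms nothing remains to be done. With perfect residue field, the bound on the discriminant
says that `p` has `T`-valuation at least `(p - 1) * m`; then `N (1 + y)` is close to `1 + N y`, and
successive approximation adjusts the uniformizer of `T` until its norm is close enough to that of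
`t'` (`exists_norm_approx`). -/

theorem pow_dvd_iff_le_addVal {t : R} (ht : Irreducible t) {n : ℕ} {x : R} :
    t ^ n ∣ x ↔ (n : ℕ∞) ≤ addVal R x := by
  rw [← ht.addVal_pow, addVal_le_iff_dvd]

theorem addVal_eq_natCast_iff {t : R} (ht : Irreducible t) {n : ℕ} {x : R} :
    addVal R x = n ↔ ∃ u : Rˣ, x = t ^ n * u := by
  rw [← ht.addVal_pow, addVal_eq_iff_associated]
  exact ⟨fun h => (h.symm).imp fun u hu => hu.symm, fun ⟨u, hu⟩ => Associated.symm ⟨u, hu.symm⟩⟩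

/-- A sum whose nonzero terms have pairwise distinct valuations has the minimal one. -/
theorem le_addVal_of_le_addVal_sum {ι : Type*} (s : Finset ι) (a : ι → R)
    (h : ∀ i ∈ s, ∀ j ∈ s, i ≠ j → a i ≠ 0 → addVal R (a i) ≠ addVal R (a j)) {n : ℕ∞}
    (hn : n ≤ addVal R (∑ i ∈ s, a i)) : ∀ i ∈ s, n ≤ addVal R (a i) := by
  classical
  by_contra! hc
  obtain ⟨i, hi, hin⟩ := hc
  obtain ⟨i₀, hi₀, hmin⟩ := s.exists_min_image (fun i => addVal R (a i)) ⟨i, hi⟩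
  have h₀ : addVal R (a i₀) < n := (hmin i hi).trans_lt hin
  have hne : a i₀ ≠ 0 := fun h => by simp [h] at h₀
  have hlt : addVal R (a i₀) < addVal R (∑ j ∈ s.erase i₀, a j) := by
    refine AddValuation.map_lt_sum' _ (h₀.trans_le le_top) fun j hj => ?_
    have hj' := Finset.mem_erase.1 hj
    exact (hmin j hj'.2).lt_of_ne (h i₀ hi₀ j hj'.2 hj'.1.symm hne)
  rw [← Finset.add_sum_erase s a hi₀, AddValuation.map_add_eq_of_lt_left _ hlt] at hn
  exact absurd hn h₀.not_ge

end Valuation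

variable {p m : ℕ} {S T : Type*} [CommRing S] [IsDomain S] [IsDiscreteValuationRing S]
  [CommRing T] [IsDomain T] [IsDiscreteValuationRing T]
  [Algebra S T] [Module.Finite S T] [FaithfulSMul S T] {σ : T ≃ₐ[S] T} {t : T}

theorem addVal_algEquiv (g : T ≃ₐ[S] T) (x : T) : addVal T (g x) = addVal T x := by
  obtain ⟨t, ht⟩ := exists_irreducible T
  have hg : Irreducible (g t) := (MulEquiv.irreducible_iff g.toMulEquiv).2 ht
  rcases eq_or_ne x 0 with rfl | hx
  · simp
  obtain ⟨n, u, rfl⟩ := eq_unit_mul_pow_irreducible hx ht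
  rw [map_mul, map_pow, addVal_def' u ht]
  exact addVal_def' (Units.map g.toRingEquiv.toMonoidHom u) hg n

/-- Multiplication by `t` after `σ`, as an `S`-linear endomorphism of `T`. -/
noncomputable def shift (σ : T ≃ₐ[S] T) (t : T) : Module.End S T :=
  LinearMap.mulLeft S t ∘ₗ σ.toLinearMap

theorem shift_apply (z : T) : shift σ t z = t * σ z := rfl

theorem shift_pow_apply (k : ℕ) (z : T) :
    (shift σ t ^ k) z = (shift σ t ^ k) 1 * (σ ^ k) z := by
  induction k with
  | zero => simp
  | succ k ih =>
    rw [pow_succ', Module.End.mul_apply, Module.End.mul_apply, ih, shift_apply, shift_apply, map_mul,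
      pow_succ' σ, AlgEquiv.mul_apply, mul_assoc]

theorem shift_pow_one (k : ℕ) : (shift σ t ^ k) 1 = ∏ i ∈ Finset.range k, (σ ^ i) t := by
  induction k with
  | zero => simp
  | succ k ih =>
    rw [pow_succ, Module.End.mul_apply, shift_apply, map_one, mul_one, shift_pow_apply, ih,
      Finset.prod_range_succ]

variable (p S T) in
/-- The extension `T | S` has degree and ramification index `p`. -/
structure IsTotallyRamified : Prop where
  degree_ne_zero : p ≠ 0
  addVal_algebraMap : ∀ c : S, addVal T (algebraMap S T c) = p * addVal S c
  finrank_eq : Module.finrank S T = p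

variable (p σ t m) in
/-- The automorphism `σ` generates the group of automorphisms of the purely ramified extension
`T | S` of degree `p`, `t` generates the maximal ideal of `T`, and `m` is the ramification break:
`σ t / t - 1` has valuation `m`. -/
structure HasBreak : Prop extends IsTotallyRamified p S T where
  prime : p.Prime
  irreducible : Irreducible t
  break_pos : 0 < m
  exists_eq_pow : ∀ g : T ≃ₐ[S] T, ∃ k < p, g = σ ^ k
  pow_eq_one : σ ^ p = 1
  addVal_sub : addVal T (σ t - t) = (m + 1 : ℕ)
  dvd_natCast : t ∣ (p : T)
  norm_eq : ∀ x : T, algebraMap S T (Algebra.norm S x) = ∏ k ∈ Finset.range p, (σ ^ k) x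

theorem addVal_shift_pow (ht : Irreducible t) (k : ℕ) (z : T) :
    addVal T ((shift σ t ^ k) z) = k + addVal T z := by
  induction k generalizing z with
  | zero => simp
  | succ k ih =>
    rw [pow_succ, Module.End.mul_apply, ih, shift_apply, addVal_mul, addVal_uniformizer ht,
      addVal_algEquiv]
    push_cast
    ring

theorem shift_pow_injective (ht : Irreducible t) (k : ℕ) :
    Function.Injective (shift σ t ^ k) := by
  rw [injective_iff_map_eq_zero]
  intro z hz
  have := addVal_shift_pow (σ := σ) ht k z
  rw [hz, addVal_zero, eq_comm, ENat.add_eq_top] at this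
  exact addVal_eq_top_iff.1 (this.resolve_left (ENat.natCast_ne_top k))

theorem exists_shift_pow_eq (ht : Irreducible t) {k : ℕ} {x : T} (hx : t ^ k ∣ x) :
    ∃ z, (shift σ t ^ k) z = x := by
  have h1 := (addVal_shift_pow (σ := σ) ht k 1)
  rw [addVal_one, add_zero, addVal_eq_natCast_iff ht] at h1
  obtain ⟨u, hu⟩ := h1
  obtain ⟨w, rfl⟩ := hx
  refine ⟨(σ ^ k)⁻¹ (↑u⁻¹ * w), ?_⟩
  rw [shift_pow_apply, hu, ← AlgEquiv.mul_apply, mul_inv_cancel, AlgEquiv.one_apply, mul_assoc,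
    Units.mul_inv_cancel_left]

namespace IsTotallyRamified

variable (h : IsTotallyRamified p S T)
include h

theorem addVal_smul {a : T} {k : ℕ} (ha : addVal T a = k) (c : S) :
    addVal T (c • a) = p * addVal S c + k := by
  rw [Algebra.smul_def, addVal_mul, h.addVal_algebraMap, ha]

variable {a : Fin p → T} (ha : ∀ k, addVal T (a k) = (k : ℕ))
include ha

/-- Elements of `S` have `T`-valuation divisible by `p`, so the nonzero terms have valuations in
distinct classes modulo `p` and cannot cancel. -/
theorem le_addVal_of_le_addVal_sum (c : Fin p → S) {n : ℕ∞}
    (hn : n ≤ addVal T (∑ k, c k • a k)) (k : Fin p) :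
    n ≤ p * addVal S (c k) + (k : ℕ) := by
  rw [← h.addVal_smul (ha k)]
  refine PurelyRamified.le_addVal_of_le_addVal_sum _ _ ?_ hn k (Finset.mem_univ k)
  intro i _ j _ hij hi he
  have hci : c i ≠ 0 := fun h0 => hi (by simp [h0])
  have hcj : c j ≠ 0 := by
    intro h0
    rw [h0, zero_smul, addVal_zero, addVal_eq_top_iff] at he
    exact hi he
  rw [h.addVal_smul (ha i), h.addVal_smul (ha j)] at he
  obtain ⟨x, hx⟩ := ENat.ne_top_iff_exists.1 (mt addVal_eq_top_iff.1 hci)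
  obtain ⟨y, hy⟩ := ENat.ne_top_iff_exists.1 (mt addVal_eq_top_iff.1 hcj)
  rw [← hx, ← hy] at he
  norm_cast at he
  have := congrArg (· % p) he
  simp only [Nat.mul_add_mod, Nat.mod_eq_of_lt i.2, Nat.mod_eq_of_lt j.2] at this
  exact hij (Fin.ext this)

theorem linearIndependent : LinearIndependent S a := by
  rw [Fintype.linearIndependent_iff]
  intro c hc k
  have := h.le_addVal_of_le_addVal_sum ha c (n := ⊤) (by rw [hc, addVal_zero]) k
  rw [← h.addVal_smul (ha k), top_le_iff, addVal_eq_top_iff, smul_eq_zero] at this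
  refine this.resolve_right fun h0 => ?_
  have hk := ha k
  rw [h0, addVal_zero] at hk
  exact ENat.natCast_ne_top _ hk.symm

attribute [local instance] Ideal.Quotient.field in
-- By Nakayama it suffices to work modulo `s`. There a relation lifts to a sum of valuation at least
-- `p`; since `k < p`, every coefficient must be divisible by `s`. Thus there are `p` independent
-- vectors in a space of dimension `p`.
theorem span_eq_top : Submodule.span S (Set.range a) = ⊤ := by
  have : NeZero p := ⟨h.degree_ne_zero⟩
  rw [← IsLocalRing.quotient_span_eq_top_iff_span_eq_top, ← Set.range_comp]
  have : Module.Finite (S ⧸ maximalIdeal S) (T ⧸ (maximalIdeal S).map (algebraMap S T)) :=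
    Module.Finite.of_restrictScalars_finite S _ _
  refine LinearIndependent.span_eq_top_of_card_eq_finrank' ?_
    (by rw [IsLocalRing.finrank_quotient_map, h.finrank_eq, Fintype.card_fin])
  rw [Fintype.linearIndependent_iff]
  intro c hc k
  choose d hd using fun k => Ideal.Quotient.mk_surjective (c k)
  obtain ⟨s, hs⟩ := exists_irreducible S
  have hmem : ∑ k, d k • a k ∈ (maximalIdeal S).map (algebraMap S T) := by
    rw [← Ideal.Quotient.eq_zero_iff_mem, map_sum, ← hc]
    refine Finset.sum_congr rfl fun k _ => ?_
    rw [← hd, Algebra.smul_def, map_mul, Algebra.smul_def]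
    rfl
  rw [hs.maximalIdeal_eq, Ideal.map_span, Set.image_singleton, Ideal.mem_span_singleton,
    ← addVal_le_iff_dvd, h.addVal_algebraMap, addVal_uniformizer hs, mul_one] at hmem
  have hk := h.le_addVal_of_le_addVal_sum ha d hmem k
  rw [← hd, Ideal.Quotient.eq_zero_iff_mem, hs.maximalIdeal_eq, Ideal.mem_span_singleton,
    ← addVal_le_iff_dvd, addVal_uniformizer hs, Order.one_le_iff_ne_zero]
  intro h0
  rw [h0, mul_zero, zero_add] at hk
  exact absurd (ENat.natCast_le_natCast.1 hk) k.2.not_ge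

omit ha

theorem adjoin_eq_top (ht : Irreducible t) : Algebra.adjoin S {t} = ⊤ := by
  rw [← Algebra.toSubmodule_eq_top, ← top_le_iff,
    ← h.span_eq_top (a := fun k => t ^ (k : ℕ)) fun k => ht.addVal_pow k, Submodule.span_le]
  rintro _ ⟨k, rfl⟩
  exact Subalgebra.pow_mem _ (Algebra.self_mem_adjoin_singleton S t) _

theorem exists_eq_algebraMap_add (ht : Irreducible t) (x : T) :
    ∃ c : S, ∃ y : T, x = algebraMap S T c + t * y := by
  have hx : x ∈ Submodule.span S (Set.range fun k : Fin p => t ^ (k : ℕ)) :=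
    h.span_eq_top (a := fun k => t ^ (k : ℕ)) (fun k => ht.addVal_pow k) ▸ Submodule.mem_top
  induction hx using Submodule.span_induction with
  | mem x hx =>
    obtain ⟨⟨k, hk⟩, rfl⟩ := hx
    rcases k with _ | k
    · exact ⟨1, 0, by simp⟩
    · exact ⟨0, t ^ k, by simp [pow_succ']⟩
  | zero => exact ⟨0, 0, by simp⟩
  | add x y _ _ hx hy =>
    obtain ⟨c, x, rfl⟩ := hx
    obtain ⟨d, y, rfl⟩ := hy
    exact ⟨c + d, x + y, by rw [map_add]; ring⟩
  | smul c x _ hx =>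
    obtain ⟨d, x, rfl⟩ := hx
    exact ⟨c * d, c • x, by simp [Algebra.smul_def]; ring⟩

end IsTotallyRamified

namespace HasBreak

variable (h : HasBreak p m σ t)
include h

theorem addVal_shift_pow_one (k : Fin p) : addVal T ((shift σ t ^ (k : ℕ)) 1) = (k : ℕ) := by
  rw [addVal_shift_pow h.irreducible, addVal_one, add_zero]

/-- The `S`-basis of `T` given by the orbit of `1` under the shift. -/
noncomputable def basis : Module.Basis (Fin p) S T :=
  .mk (h.linearIndependent h.addVal_shift_pow_one) (h.span_eq_top h.addVal_shift_pow_one).ge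

theorem basis_apply (k : Fin p) : h.basis k = (shift σ t ^ (k : ℕ)) 1 := by
  simp [basis]

theorem le_addVal_iff (n : ℕ∞) (x : T) :
    n ≤ addVal T x ↔ ∀ k, n ≤ p * addVal S (h.basis.repr x k) + (k : ℕ) := by
  constructor
  · intro hn
    refine h.le_addVal_of_le_addVal_sum h.addVal_shift_pow_one _ ?_
    simp_rw [← h.basis_apply, h.basis.sum_repr]
    exact hn
  · intro hn
    rw [← h.basis.sum_repr x]
    refine AddValuation.map_le_sum _ fun k _ => ?_
    rw [h.basis_apply, h.addVal_smul (h.addVal_shift_pow_one k)]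
    exact hn k

theorem shift_pow_eq (z : T) : (shift σ t ^ p) z = Algebra.norm S t • z := by
  rw [shift_pow_apply, shift_pow_one, ← h.norm_eq, h.pow_eq_one, AlgEquiv.one_apply,
    Algebra.smul_def]

/-- The shift basis makes `T` generated from `S` by sums and shifts. -/
theorem induction_on {P : T → Prop} (x : T) (halg : ∀ c : S, P (algebraMap S T c))
    (hadd : ∀ x y, P x → P y → P (x + y)) (hmul : ∀ x, P x → P (shift σ t x)) : P x := by
  have hsmul : ∀ (k : ℕ) (c : S), P (c • (shift σ t ^ k) 1) := by
    intro k
    induction k with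
    | zero => exact fun c => by simpa [Algebra.smul_def] using halg c
    | succ k ih =>
      intro c
      rw [pow_succ', Module.End.mul_apply, ← map_smul]
      exact hmul _ (ih c)
  rw [← h.basis.sum_repr x]
  refine Finset.sum_induction _ P (fun x y => hadd x y) (by simpa using halg 0) fun k _ => ?_
  rw [h.basis_apply]
  exact hsmul _ _

end HasBreak

end PurelyRamified

/-! ### How `σ - 1` raises valuations. -/

namespace PurelyRamified

variable {p m : ℕ} {S T : Type*} [CommRing S] [IsDomain S] [IsDiscreteValuationRing S]
  [CommRing T] [IsDomain T] [IsDiscreteValuationRing T]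
  [Algebra S T] [Module.Finite S T] [FaithfulSMul S T] {σ : T ≃ₐ[S] T} {t : T}

section Valuation

variable {R : Type*} [CommRing R] [IsDomain R] [IsDiscreteValuationRing R]

theorem le_addVal_add {n : ℕ∞} {x y : R} (hx : n ≤ addVal R x) (hy : n ≤ addVal R y) :
    n ≤ addVal R (x + y) :=
  AddValuation.map_le_add _ hx hy

theorem addVal_natCast_eq_zero {t : R} (ht : Irreducible t) (hp : p.Prime) (htp : t ∣ (p : R))
    {n : ℕ} (hn : ¬p ∣ n) : addVal R (n : R) = 0 := by
  rw [addVal_eq_zero_iff]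
  by_contra hu
  have htn : t ∣ (n : R) := by
    rwa [← Ideal.mem_span_singleton, ← ht.maximalIdeal_eq, mem_maximalIdeal]
  have hc : IsCoprime (p : R) (n : R) := by
    have := (Nat.isCoprime_iff_coprime.2 ((Nat.Prime.coprime_iff_not_dvd hp).2 hn)).map
      (Int.castRingHom R)
    simpa using this
  exact ht.not_isUnit (hc.isUnit_of_dvd' htp htn)

end Valuation

namespace HasBreak

variable (h : HasBreak p m σ t)
include h

/-- The twisted Leibniz rule for `σ - 1` on a shift gives the bound `m` for all elements; peeling
off one shift at a time then adds the valuation of `x`. -/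
theorem le_addVal_generator_sub (x : T) : addVal T x + m ≤ addVal T (σ x - x) := by
  have key : ∀ z : T, σ (shift σ t z) - shift σ t z = (σ t - t) * σ (σ z) + t * σ (σ z - z) := by
    intro z
    simp only [shift_apply, map_mul, map_sub]
    ring
  have h1 : ∀ x : T, (m : ℕ∞) ≤ addVal T (σ x - x) := by
    intro x
    refine h.induction_on (P := fun x => (m : ℕ∞) ≤ addVal T (σ x - x)) x (fun c => by simp)
      (fun x y hx hy => ?_) fun x hx => ?_
    · rw [map_add, add_sub_add_comm]
      exact le_addVal_add hx hy
    · rw [key]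
      refine le_addVal_add ?_ ?_
      · rw [addVal_mul, h.addVal_sub]
        exact (ENat.natCast_le_natCast.2 (Nat.le_succ m)).trans le_self_add
      · rw [addVal_mul, addVal_algEquiv]
        exact hx.trans le_add_self
  rcases eq_or_ne x 0 with rfl | hx
  · simp
  obtain ⟨n, hn⟩ := ENat.ne_top_iff_exists.1 (mt addVal_eq_top_iff.1 hx)
  induction n generalizing x with
  | zero => simpa [← hn] using h1 x
  | succ n ih =>
    obtain ⟨z, rfl⟩ := exists_shift_pow_eq (σ := σ) (k := 1) (x := x) h.irreducible
      ((pow_dvd_iff_le_addVal h.irreducible).2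
        ((ENat.natCast_le_natCast.2 (Nat.le_add_left 1 n)).trans hn.le))
    have hz : (n : ℕ∞) = addVal T z := by
      rw [addVal_shift_pow h.irreducible, Nat.cast_succ, add_comm, Nat.cast_one] at hn
      exact ENat.add_right_injective_of_ne_top ENat.one_ne_top hn
    have hz0 : z ≠ 0 := fun h0 => by simp [h0] at hz
    have := ih z hz0 hz
    rw [← hn, pow_one, key]
    refine le_addVal_add ?_ ?_
    · rw [addVal_mul, h.addVal_sub, addVal_algEquiv, addVal_algEquiv, ← hz]
      norm_cast
      omega
    · rw [addVal_mul, addVal_algEquiv, addVal_uniformizer h.irreducible]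
      rw [← hz] at this
      calc ((n + 1 : ℕ) : ℕ∞) + m = 1 + (n + m) := by push_cast; ring
        _ ≤ _ := add_le_add_right this _

theorem le_addVal_pow_sub (k : ℕ) (x : T) : addVal T x + m ≤ addVal T ((σ ^ k) x - x) := by
  induction k with
  | zero => simp
  | succ k ih =>
    have : (σ ^ (k + 1)) x - x = σ ((σ ^ k) x - x) + (σ x - x) := by
      rw [pow_succ', AlgEquiv.mul_apply, map_sub]
      ring
    rw [this]
    exact le_addVal_add (by rwa [addVal_algEquiv]) (h.le_addVal_generator_sub x)

theorem le_addVal_sub (g : T ≃ₐ[S] T) (x : T) : addVal T x + m ≤ addVal T (g x - x) := by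
  obtain ⟨k, -, rfl⟩ := h.exists_eq_pow g
  exact h.le_addVal_pow_sub k x

/-- Modulo `t ^ (m + 2)`, `σ ^ n t - t` is `n * (σ t - t)`, and `n` is a unit when `p` does not
divide it. -/
theorem addVal_pow_sub_self {n : ℕ} (hn : ¬p ∣ n) :
    addVal T ((σ ^ n) t - t) = (m + 1 : ℕ) := by
  have key : ∀ n : ℕ, ((m + 2 : ℕ) : ℕ∞) ≤
      addVal T ((σ ^ n) t - t - n * (σ t - t)) := by
    intro n
    induction n with
    | zero => simp
    | succ n ih =>
      have : (σ ^ (n + 1)) t - t - (n + 1 : ℕ) * (σ t - t) =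
          ((σ ^ n) t - t - n * (σ t - t)) + ((σ ^ n) (σ t - t) - (σ t - t)) := by
        rw [pow_succ, AlgEquiv.mul_apply, map_sub]
        push_cast
        ring
      rw [this]
      refine le_addVal_add ih (le_trans ?_ (h.le_addVal_pow_sub n _))
      rw [h.addVal_sub]
      have := h.break_pos
      norm_cast
      omega
  have hv : addVal T (n * (σ t - t)) = (m + 1 : ℕ) := by
    rw [addVal_mul, addVal_natCast_eq_zero h.irreducible h.prime h.dvd_natCast hn, zero_add,
      h.addVal_sub]
  rw [← hv, ← AddValuation.map_add_eq_of_lt_left (addVal T) (x := n * (σ t - t))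
    (y := (σ ^ n) t - t - n * (σ t - t)), add_sub_cancel]
  rw [hv]
  exact (ENat.natCast_lt_natCast.2 (by omega)).trans_le (key n)

/-- The generator raises valuations prime to `p` by exactly the ramification break. -/
theorem addVal_sub_eq {n : ℕ} (hn : ¬p ∣ n) {x : T} (hx : addVal T x = n) :
    addVal T (σ x - x) = (n + m : ℕ) := by
  -- Write `x` as the `n`-th shift of `c + t * y` with `c` a unit of `S`; the `y` part only
  -- contributes higher valuation.
  obtain ⟨w, rfl⟩ := exists_shift_pow_eq (σ := σ) h.irreducible
    ((pow_dvd_iff_le_addVal h.irreducible).2 hx.ge)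
  obtain ⟨c, y, rfl⟩ := h.exists_eq_algebraMap_add h.irreducible w
  have hc : addVal T (algebraMap S T c) = 0 := by
    rw [addVal_shift_pow h.irreducible] at hx
    have hw := ENat.add_right_injective_of_ne_top (ENat.natCast_ne_top n)
      (hx.trans (add_zero (n : ℕ∞)).symm)
    rw [addVal_eq_zero_iff] at hw ⊢
    by_contra hcu
    refine mem_maximalIdeal _ |>.1 (Ideal.add_mem _ ((mem_maximalIdeal _).2 hcu)
      (Ideal.mul_mem_right y _ ?_)) hw
    exact (mem_maximalIdeal _).2 h.irreducible.not_isUnit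
  have hbase : addVal T (σ ((shift σ t ^ n) 1) - (shift σ t ^ n) 1) = (n + m : ℕ) := by
    -- The `n`-th shift of 1 is the product of the first `n` conjugates of `t`, so applying `σ`
    -- replaces the factor `t` by `σ ^ n t`.
    have : t * (σ ((shift σ t ^ n) 1) - (shift σ t ^ n) 1) =
        (shift σ t ^ n) 1 * ((σ ^ n) t - t) := by
      rw [mul_sub, ← shift_apply, ← Module.End.mul_apply, ← pow_succ', pow_succ,
        Module.End.mul_apply, shift_apply (1 : T), map_one, mul_one, shift_pow_apply n t]
      ring
    have := congrArg (addVal T) this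
    rw [addVal_mul, addVal_mul, addVal_uniformizer h.irreducible, h.addVal_pow_sub_self hn,
      addVal_shift_pow h.irreducible, addVal_one, add_zero] at this
    refine ENat.add_right_injective_of_ne_top ENat.one_ne_top (this.trans ?_)
    push_cast
    ring
  have hsplit : σ ((shift σ t ^ n) (algebraMap S T c + t * y)) -
      (shift σ t ^ n) (algebraMap S T c + t * y) =
      algebraMap S T c * (σ ((shift σ t ^ n) 1) - (shift σ t ^ n) 1) +
      (σ ((shift σ t ^ n) (t * y)) - (shift σ t ^ n) (t * y)) := by
    rw [map_add, map_add, Algebra.algebraMap_eq_smul_one, map_smul, map_smul, smul_mul_assoc,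
      one_mul, smul_sub]
    ring
  have hv : addVal T (algebraMap S T c * (σ ((shift σ t ^ n) 1) - (shift σ t ^ n) 1)) =
      (n + m : ℕ) := by
    rw [addVal_mul, hc, zero_add, hbase]
  rw [hsplit, AddValuation.map_add_eq_of_lt_left, hv]
  rw [hv]
  refine lt_of_lt_of_le ?_ (h.le_addVal_generator_sub _)
  rw [addVal_shift_pow h.irreducible, addVal_mul, addVal_uniformizer h.irreducible]
  calc ((n + m : ℕ) : ℕ∞) < (n + 1 + m : ℕ) := ENat.natCast_lt_natCast.2 (by omega)
    _ ≤ n + (1 + addVal T y) + m := by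
      push_cast
      gcongr
      exact le_self_add

end HasBreak

end PurelyRamified

/-! ### The image of the twisted group ring in the endomorphism ring. -/

namespace PurelyRamified

section Embedding

variable (S T : Type*) [CommRing S] [CommRing T] [Algebra S T]

/-- The action of the twisted group ring `T ≀ G` on `T`. -/
noncomputable def twistedAction : TwistedGroupRing S T →ₐ[S] Module.End S T :=
  SkewMonoidAlgebra.liftNCAlgHom (Algebra.lmul S T)
    (DistribMulAction.toModuleEnd S T (S := T ≃ₐ[S] T)) <| by
      intro x g
      ext z
      simp

variable {S T}

theorem twistedAction_single (g : T ≃ₐ[S] T) (y : T) :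
    twistedAction S T (SkewMonoidAlgebra.single g y) =
      LinearMap.mulLeft S y ∘ₗ g.toLinearMap := by
  ext z
  simp [twistedAction, SkewMonoidAlgebra.liftNCAlgHom, SkewMonoidAlgebra.liftNCRingHom]

theorem twistedAction_apply (f : TwistedGroupRing S T) (x : T) :
    twistedAction S T f x = f.coeff.sum fun g y => y * g x := by
  induction f using SkewMonoidAlgebra.induction_on with
  | zero => simp
  | single g y => rw [twistedAction_single]; simp
  | add f g hf hg =>
    rw [map_add, LinearMap.add_apply, hf, hg, SkewMonoidAlgebra.coeff_add,
      Finsupp.sum_add_index' (by simp) (by simp [add_mul])]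

/-- This is Dedekind's linear independence of multiplicative maps. -/
theorem twistedAction_injective [IsDomain T] : Function.Injective (twistedAction S T) := by
  rw [injective_iff_map_eq_zero]
  intro f hf
  have hli : LinearIndependent T fun g : T ≃ₐ[S] T => (g : T → T) :=
    (linearIndependent_monoidHom T T).comp (fun g : T ≃ₐ[S] T => (g : T →* T)) fun g g' hg =>
      AlgEquiv.ext fun x => DFunLike.congr_fun hg x
  rw [← SkewMonoidAlgebra.coeff_eq_zero]
  refine (linearIndependent_iff.1 hli) f.coeff ?_
  ext x
  rw [Finsupp.linearCombination_apply, Finsupp.sum, Finset.sum_apply]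
  have := LinearMap.congr_fun hf x
  rw [twistedAction_apply] at this
  simpa [Finsupp.sum] using this

theorem mulLeft_comp_mem_range (y : T) (g : T ≃ₐ[S] T) :
    LinearMap.mulLeft S y ∘ₗ g.toLinearMap ∈ (twistedAction S T).range :=
  ⟨_, twistedAction_single g y⟩

theorem mulLeft_mul_mem_range (y : T) {f : Module.End S T} (hf : f ∈ (twistedAction S T).range) :
    LinearMap.mulLeft S y * f ∈ (twistedAction S T).range :=
  Subalgebra.mul_mem _ (mulLeft_comp_mem_range y 1) hf

theorem algEquiv_mul_mem_range (g : T ≃ₐ[S] T) {f : Module.End S T}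
    (hf : f ∈ (twistedAction S T).range) : g.toLinearMap * f ∈ (twistedAction S T).range := by
  refine Subalgebra.mul_mem _ ?_ hf
  have := mulLeft_comp_mem_range (S := S) 1 g
  rwa [LinearMap.mulLeft_one, LinearMap.id_comp] at this

theorem range_induction {P : Module.End S T → Prop}
    (hadd : ∀ f g, P f → P g → P (f + g))
    (hsingle : ∀ (y : T) (g : T ≃ₐ[S] T), P (LinearMap.mulLeft S y ∘ₗ g.toLinearMap))
    {f : Module.End S T} (hf : f ∈ (twistedAction S T).range) : P f := by
  obtain ⟨f, rfl⟩ := hf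
  change P (twistedAction S T f)
  induction f using SkewMonoidAlgebra.induction_on with
  | zero => simpa using hsingle 0 1
  | single g y => rw [twistedAction_single]; exact hsingle y g
  | add f g hf hg => rw [map_add]; exact hadd _ _ hf hg

end Embedding

theorem fwdDiff_iter_pow_apply {R M : Type*} [Semiring R] [AddCommGroup M] [Module R M]
    (τ : Module.End R M) (y : M) (i j : ℕ) :
    (fwdDiff 1)^[i] (fun j : ℕ => (τ ^ j) y) j = (τ ^ j) (((τ - 1) ^ i) y) := by
  induction i generalizing y with
  | zero => simp
  | succ i ih =>
    have : fwdDiff 1 (fun j : ℕ => (τ ^ j) y) = fun j => (τ ^ j) ((τ - 1) y) :=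
      funext fun j => by simp [fwdDiff, pow_succ]
    rw [Function.iterate_succ_apply, this, ih, pow_succ, Module.End.mul_apply]

variable {p m : ℕ} {S T : Type*} [CommRing S] [IsDomain S] [IsDiscreteValuationRing S]
  [CommRing T] [IsDomain T] [IsDiscreteValuationRing T]
  [Algebra S T] [Module.Finite S T] [FaithfulSMul S T] {σ : T ≃ₐ[S] T} {t : T}

theorem le_addVal_fwdDiff_iter {n : ℕ∞} {z : ℕ → T} {i : ℕ}
    (hz : ∀ k ≤ i, n ≤ addVal T (z k)) : n ≤ addVal T ((fwdDiff 1)^[i] z 0) := by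
  rw [fwdDiff_iter_eq_sum_shift]
  refine AddValuation.map_le_sum _ fun k hk => ?_
  rw [zsmul_eq_mul, addVal_mul]
  refine (hz _ ?_).trans le_add_self
  have := Finset.mem_range.1 hk
  simp only [smul_eq_mul, mul_one, zero_add]
  omega

variable (p σ t m) in
/-- The congruences between the matrix entries of an endomorphism of `T`, with respect to the
orbit of `1` under the shift, that describe the image of the twisted group ring. -/
def HasTies (f : Module.End S T) : Prop :=
  ∃ z : ℕ → T, (∀ j < p, f ((shift σ t ^ j) 1) = (shift σ t ^ j) (z j)) ∧
    ∀ i < p, ((i * m : ℕ) : ℕ∞) ≤ addVal T ((fwdDiff 1)^[i] z 0)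

theorem HasTies.add {f g : Module.End S T} (hf : HasTies p m σ t f) (hg : HasTies p m σ t g) :
    HasTies p m σ t (f + g) := by
  obtain ⟨z, hz, hz'⟩ := hf
  obtain ⟨w, hw, hw'⟩ := hg
  refine ⟨z + w, fun j hj => ?_, fun i hi => ?_⟩
  · rw [LinearMap.add_apply, hz j hj, hw j hj, Pi.add_apply, map_add]
  · rw [fwdDiff_iter_add]
    exact le_addVal_add (hz' i hi) (hw' i hi)

namespace HasBreak

variable (h : HasBreak p m σ t)
include h

/-- Moving `y * g` past a shift turns `y` into `τ y`, where `τ w = σ⁻¹ (ω * w)` and `g t = t * ω`.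
Hence `z j = τ ^ j y`, whose `i`-th difference at 0 is `(τ - 1) ^ i y`. Since `ω - 1` and `σ - 1`
both raise valuations by at least `m`, so does `τ - 1`. -/
theorem hasTies_mulLeft_comp (y : T) (g : T ≃ₐ[S] T) :
    HasTies p m σ t (LinearMap.mulLeft S y ∘ₗ g.toLinearMap) := by
  obtain ⟨ω, hω⟩ : t ∣ g t := by
    rw [← addVal_le_iff_dvd, addVal_algEquiv]
  have hω1 : (m : ℕ∞) ≤ addVal T (ω - 1) := by
    have := h.le_addVal_sub g t
    rw [hω, show t * ω - t = t * (ω - 1) by ring, addVal_mul, addVal_uniformizer h.irreducible]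
      at this
    exact (ENat.add_le_add_iff_left ENat.one_ne_top).1 this
  have hgσ : ∀ x, g (σ x) = σ (g x) := by
    obtain ⟨k, -, rfl⟩ := h.exists_eq_pow g
    intro x
    rw [← AlgEquiv.mul_apply, ← AlgEquiv.mul_apply, ← pow_succ, ← pow_succ']
  set τ : Module.End S T := σ⁻¹.toLinearMap ∘ₗ LinearMap.mulLeft S ω with hτ
  have hτ_apply : ∀ w, σ (τ w) = ω * w := by
    intro w
    rw [hτ]
    simp only [LinearMap.comp_apply, LinearMap.mulLeft_apply, AlgEquiv.toLinearMap_apply]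
    rw [← AlgEquiv.mul_apply, mul_inv_cancel, AlgEquiv.one_apply]
  have hτ_sub : ∀ w, addVal T w + m ≤ addVal T ((τ - 1) w) := by
    intro w
    rw [← addVal_algEquiv σ ((τ - 1) w), LinearMap.sub_apply, map_sub, hτ_apply, Module.End.one_apply,
      show ω * w - σ w = (ω - 1) * w + (w - σ w) by ring]
    refine le_addVal_add ?_ ?_
    · rw [addVal_mul, add_comm]
      gcongr
    · rw [AddValuation.map_sub_swap]
      exact h.le_addVal_generator_sub w
  refine ⟨fun j => (τ ^ j) y, fun j _ => ?_, fun i _ => ?_⟩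
  · have key : ∀ (j : ℕ) (y x : T), y * g ((shift σ t ^ j) x) =
        (shift σ t ^ j) ((τ ^ j) y * g x) := by
      intro j
      induction j with
      | zero => simp
      | succ j ih =>
        intro y x
        rw [pow_succ, pow_succ' τ, Module.End.mul_apply, Module.End.mul_apply,
          Module.End.mul_apply, ih, shift_apply, shift_apply, map_mul g, map_mul σ, hω, hgσ, hτ_apply]
        congr 1
        ring
    simpa using key j y 1
  · rw [fwdDiff_iter_pow_apply, pow_zero, Module.End.one_apply]
    induction i with
    | zero => simp
    | succ i ih =>
      rw [pow_succ', Module.End.mul_apply]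
      refine le_trans ?_ (hτ_sub _)
      rw [add_mul, one_mul, Nat.cast_add]
      gcongr
      exact ih (by omega)

theorem hasTies_of_mem_range {f : Module.End S T} (hf : f ∈ (twistedAction S T).range) :
    HasTies p m σ t f :=
  range_induction (fun _ _ => HasTies.add) h.hasTies_mulLeft_comp hf

/-- A triangular system of elements of the twisted group ring. -/
theorem exists_mem_range_triangular (i : ℕ) (hi : i < p) :
    ∃ g ∈ (twistedAction S T).range, (∀ j < i, g ((shift σ t ^ j) 1) = 0) ∧
      ∀ j, i ≤ j → j < p → addVal T (g ((shift σ t ^ j) 1)) = (j + i * m : ℕ) := by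
  induction i with
  | zero =>
    refine ⟨1, Subalgebra.one_mem _, by simp, fun j _ _ => ?_⟩
    rw [Module.End.one_apply, addVal_shift_pow h.irreducible]
    simp
  | succ i ih =>
    obtain ⟨g, hg, hg0, hgv⟩ := ih (by omega)
    set v := g ((shift σ t ^ i) 1) with hv
    have hvv := hgv i le_rfl (by omega)
    have hv0 : v ≠ 0 := fun h0 => by
      rw [← hv, h0, addVal_zero] at hvv
      exact ENat.natCast_ne_top _ hvv.symm
    obtain ⟨a, ha⟩ : v ∣ σ v := by rw [← addVal_le_iff_dvd, addVal_algEquiv]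
    -- The factor `a = σ v / v` is chosen to kill the `i`-th basis vector. On a later one, with
    -- value `v * w`, there remains `σ v * (σ w - w)`; `w` has valuation `j - i`, prime to `p`, so
    -- the gain is exactly `m`.
    refine ⟨σ.toLinearMap * g - LinearMap.mulLeft S a * g,
      Subalgebra.sub_mem _ (algEquiv_mul_mem_range σ hg) (mulLeft_mul_mem_range a hg),
      fun j hj => ?_, fun j hij hjp => ?_⟩
    · simp only [LinearMap.sub_apply, Module.End.mul_apply, AlgEquiv.toLinearMap_apply,
        LinearMap.mulLeft_apply]
      rcases Nat.lt_succ_iff_lt_or_eq.1 hj with hj | rfl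
      · rw [hg0 j hj, map_zero, mul_zero, sub_zero]
      · rw [← hv, ha]
        ring
    · simp only [LinearMap.sub_apply, Module.End.mul_apply, AlgEquiv.toLinearMap_apply,
        LinearMap.mulLeft_apply]
      have hjv := hgv j (by omega) hjp
      obtain ⟨w, hw⟩ : v ∣ g ((shift σ t ^ j) 1) := by
        rw [← addVal_le_iff_dvd, hvv, hjv]
        norm_cast
        omega
      rw [hw, addVal_mul, hvv] at hjv
      have hwv : addVal T w = (j - i : ℕ) := by
        refine ENat.add_right_injective_of_ne_top (ENat.natCast_ne_top (i + i * m))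
          (hjv.trans ?_)
        change ((j + i * m : ℕ) : ℕ∞) = (i + i * m : ℕ) + (j - i : ℕ)
        rw [← Nat.cast_add]
        congr 1
        omega
      have hdvd : ¬p ∣ j - i := Nat.not_dvd_of_pos_of_lt (by omega) (by omega)
      rw [hw, map_mul, ha, show v * a * σ w - a * (v * w) = (v * a) * (σ w - w) by ring, ← ha,
        addVal_mul, addVal_algEquiv, hvv, h.addVal_sub_eq hdvd hwv]
      norm_cast
      rw [add_mul, one_mul]
      omega

/-- Gaussian elimination against the triangular system. Once the first `i` values vanish, the `i`-th
difference reduces to `z i`, so the condition is precisely divisibility of the next value by the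
pivot, of valuation `i + i * m`. -/
theorem mem_range_of_hasTies {f : Module.End S T} (hf : HasTies p m σ t f) :
    f ∈ (twistedAction S T).range := by
  have key : ∀ i ≤ p, ∃ g ∈ (twistedAction S T).range,
      ∀ j < i, (f - g) ((shift σ t ^ j) 1) = 0 := by
    intro i
    induction i with
    | zero => exact fun _ => ⟨0, Subalgebra.zero_mem _, by simp⟩
    | succ i ih =>
      intro hi
      obtain ⟨g, hg, hg0⟩ := ih (by omega)
      have hties := hf.add (h.hasTies_of_mem_range (Subalgebra.neg_mem _ hg))
      rw [← sub_eq_add_neg] at hties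
      obtain ⟨z, hz, hz'⟩ := hties
      have hz0 : ∀ j < i, z j = 0 := by
        intro j hj
        refine shift_pow_injective (σ := σ) h.irreducible j ?_
        rw [← hz j (by omega), hg0 j hj, map_zero]
      have hzi : ((i * m : ℕ) : ℕ∞) ≤ addVal T (z i) := by
        have := hz' i (by omega)
        rwa [fwdDiff_iter_eq_sum_shift, Finset.sum_range_succ, Finset.sum_eq_zero, zero_add,
          Nat.sub_self, pow_zero, Nat.choose_self, Nat.cast_one, mul_one, one_smul, smul_eq_mul,
          mul_one, zero_add] at this
        intro k hk
        rw [smul_eq_mul, mul_one, zero_add, hz0 k (Finset.mem_range.1 hk), smul_zero]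
      obtain ⟨e, he, he0, hev⟩ := h.exists_mem_range_triangular i (by omega)
      obtain ⟨y, hy⟩ : e ((shift σ t ^ i) 1) ∣ (f - g) ((shift σ t ^ i) 1) := by
        rw [← addVal_le_iff_dvd, hev i le_rfl (by omega), hz i (by omega),
          addVal_shift_pow h.irreducible, Nat.cast_add]
        gcongr
      refine ⟨g + LinearMap.mulLeft S y * e,
        Subalgebra.add_mem _ hg (mulLeft_mul_mem_range y he), fun j hj => ?_⟩
      rw [← sub_sub, LinearMap.sub_apply, Module.End.mul_apply, LinearMap.mulLeft_apply]
      rcases Nat.lt_succ_iff_lt_or_eq.1 hj with hj | rfl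
      · rw [hg0 j hj, he0 j hj, mul_zero, sub_zero]
      · rw [hy]
        ring
  obtain ⟨g, hg, hg0⟩ := key p le_rfl
  suffices f = g from this ▸ hg
  rw [← sub_eq_zero]
  refine h.basis.ext fun k => ?_
  rw [h.basis_apply, hg0 k k.2, LinearMap.zero_apply]

end HasBreak

end PurelyRamified

/-! ### Transport of the image from one extension to the other. -/

namespace PurelyRamified

variable {p m : ℕ} {S T T' : Type*} [CommRing S] [IsDomain S] [IsDiscreteValuationRing S]
  [CommRing T] [IsDomain T] [IsDiscreteValuationRing T]
  [Algebra S T] [Module.Finite S T] [FaithfulSMul S T] {σ : T ≃ₐ[S] T} {t : T}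
  [CommRing T'] [IsDomain T'] [IsDiscreteValuationRing T']
  [Algebra S T'] [Module.Finite S T'] [FaithfulSMul S T'] {σ' : T' ≃ₐ[S] T'} {t' : T'}

namespace HasBreak

variable (h : HasBreak p m σ t) (h' : HasBreak p m σ' t')

/-- The `S`-linear bijection that matches the orbits of `1` under the two shifts. -/
noncomputable def compare : T ≃ₗ[S] T' := h.basis.repr.trans h'.basis.repr.symm

theorem compare_shift {k : ℕ} (hk : k < p) :
    h.compare h' ((shift σ t ^ k) 1) = (shift σ' t' ^ k) 1 := by
  have : h.compare h' (h.basis ⟨k, hk⟩) = h'.basis ⟨k, hk⟩ := by simp [compare]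
  rwa [h.basis_apply, h'.basis_apply] at this

theorem compare_symm : (h.compare h').symm = h'.compare h := rfl

/-- Both valuations are read off the same coordinates by the same formula. -/
theorem addVal_compare (x : T) : addVal T' (h.compare h' x) = addVal T x := by
  refine eq_of_forall_le_iff fun n => ?_
  rw [h.le_addVal_iff, h'.le_addVal_iff]
  simp [compare]

variable (hN : (m + 1 : ℕ) ≤ addVal S (Algebra.norm S t - Algebra.norm S t'))
include h h' hN

/-- Only the last basis vector contributes: its shift is the norm of the uniformizer times 1. The
norms agree modulo `s ^ (m + 1)`, and passing from `S` to `T'` multiplies valuations by `p`. -/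
theorem le_addVal_compare_shift_sub (z : T) :
    ((p * (m + 1) : ℕ) : ℕ∞) ≤
      addVal T' (h.compare h' (shift σ t z) - shift σ' t' (h.compare h' z)) := by
  have hk : ∀ k : Fin p, ((p * (m + 1) : ℕ) : ℕ∞) ≤
      addVal T' (h.compare h' (shift σ t (h.basis k)) - shift σ' t' (h.compare h' (h.basis k))) := by
    intro k
    rw [h.basis_apply, h.compare_shift h' k.2, ← Module.End.mul_apply, ← Module.End.mul_apply,
      ← pow_succ', ← pow_succ']
    rcases (Nat.succ_le_of_lt k.2).lt_or_eq with hk | hk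
    · rw [h.compare_shift h' hk, sub_self, addVal_zero]
      exact le_top
    · have h1 : h.compare h' 1 = 1 := by simpa using h.compare_shift h' h.prime.pos
      change _ ≤ addVal T' (h.compare h' ((shift σ t ^ (k : ℕ).succ) 1) -
        (shift σ' t' ^ (k : ℕ).succ) 1)
      rw [hk, h.shift_pow_eq, h'.shift_pow_eq, map_smul, h1, ← sub_smul, Algebra.smul_def, mul_one,
        h'.addVal_algebraMap, Nat.cast_mul]
      gcongr
  conv_rhs => rw [← h.basis.sum_repr z]
  simp only [map_sum, map_smul, ← Finset.sum_sub_distrib, ← smul_sub]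
  refine AddValuation.map_le_sum _ fun k _ => ?_
  rw [Algebra.smul_def, addVal_mul]
  exact (hk k).trans le_add_self

/-- Pulling the error inside one more shift costs one unit of valuation. Starting from `p * (m +
1)`, at least `p * m` survives all `j ≤ p`, which dominates every bound `i * m` in the ties. -/
theorem exists_compare_shift_pow {j : ℕ} (hj : j ≤ p) (z : T) :
    ∃ ε, ((p * m + p - j : ℕ) : ℕ∞) ≤ addVal T' ε ∧
      h.compare h' ((shift σ t ^ j) z) = (shift σ' t' ^ j) (h.compare h' z + ε) := by
  induction j generalizing z with
  | zero => exact ⟨0, by simp⟩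
  | succ j ih =>
    obtain ⟨ε, hε, he⟩ := ih (by omega) (shift σ t z)
    set η := h.compare h' (shift σ t z) - shift σ' t' (h.compare h' z) with hη
    have hηε : ((p * m + p - j : ℕ) : ℕ∞) ≤ addVal T' (η + ε) := by
      refine le_addVal_add (le_trans ?_ (h.le_addVal_compare_shift_sub h' hN z)) hε
      rw [mul_add, mul_one]
      exact ENat.natCast_le_natCast.2 (Nat.sub_le _ _)
    obtain ⟨ε', hε'⟩ := exists_shift_pow_eq (σ := σ') (k := 1) (x := η + ε) h'.irreducible
      ((pow_dvd_iff_le_addVal h'.irreducible).2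
        (le_trans (ENat.natCast_le_natCast.2 (by omega)) hηε))
    refine ⟨ε', ?_, ?_⟩
    · rw [← hε', addVal_shift_pow h'.irreducible,
        show p * m + p - j = 1 + (p * m + p - (j + 1)) by omega, Nat.cast_add] at hηε
      exact (ENat.add_le_add_iff_left ENat.one_ne_top).1 hηε
    · rw [pow_one] at hε'
      rw [pow_succ, pow_succ, Module.End.mul_apply, Module.End.mul_apply, he, map_add (shift σ' t'),
        hε', hη]
      congr 1
      ring

theorem hasTies_conj {f : Module.End S T} (hf : HasTies p m σ t f) :
    HasTies p m σ' t' ((h.compare h').conj f) := by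
  obtain ⟨z, hz, hz'⟩ := hf
  have hε : ∀ j, ∃ ε : T', j < p → ((p * m : ℕ) : ℕ∞) ≤ addVal T' ε ∧
      h.compare h' ((shift σ t ^ j) (z j)) = (shift σ' t' ^ j) (h.compare h' (z j) + ε) := by
    intro j
    by_cases hj : j < p
    · obtain ⟨ε, hε, he⟩ := h.exists_compare_shift_pow h' hN hj.le (z j)
      exact ⟨ε, fun _ => ⟨(ENat.natCast_le_natCast.2 (by omega)).trans hε, he⟩⟩
    · exact ⟨0, fun h => absurd h hj⟩
  choose ε hε using hε
  refine ⟨(fun j => h.compare h' (z j)) + ε, fun j hj => ?_, fun i hi => ?_⟩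
  · rw [LinearEquiv.conj_apply_apply, compare_symm, h'.compare_shift h hj, hz j hj, (hε j hj).2,
      Pi.add_apply]
  · rw [fwdDiff_iter_add]
    refine le_addVal_add ?_ ?_
    · have : (fwdDiff 1)^[i] (fun j => h.compare h' (z j)) 0 =
          h.compare h' ((fwdDiff 1)^[i] z 0) := by
        simp only [fwdDiff_iter_eq_sum_shift, map_sum, map_zsmul]
      rw [this, addVal_compare]
      exact hz' i hi
    · refine le_addVal_fwdDiff_iter fun k hk => le_trans ?_ (hε k (by omega)).1
      exact ENat.natCast_le_natCast.2 (Nat.mul_le_mul_right m hi.le)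

theorem nonempty_algEquiv :
    Nonempty (TwistedGroupRing S T ≃ₐ[S] TwistedGroupRing S T') := by
  have hN' : (m + 1 : ℕ) ≤ addVal S (Algebra.norm S t' - Algebra.norm S t) := by
    rwa [AddValuation.map_sub_swap]
  let c := (h.compare h').conjAlgEquiv S
  have hmap : (twistedAction S T).range.map c.toAlgHom = (twistedAction S T').range := by
    refine le_antisymm ?_ fun f hf => ?_
    · rintro _ ⟨f, hf, rfl⟩
      exact h'.mem_range_of_hasTies (h.hasTies_conj h' hN (h.hasTies_of_mem_range hf))
    · refine ⟨c.symm f, ?_, c.apply_symm_apply f⟩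
      exact h.mem_range_of_hasTies (h'.hasTies_conj h hN' (h'.hasTies_of_mem_range hf))
  exact ⟨(AlgEquiv.ofInjective _ twistedAction_injective).trans
    ((c.subalgebraMap _).trans ((Subalgebra.equivOfEq _ _ hmap).trans
      (AlgEquiv.ofInjective _ twistedAction_injective).symm))⟩

end HasBreak

end PurelyRamified

/-! ### Traces, and approximation of uniformizers by norms. -/

namespace PurelyRamified

/-- Modulo `p`, both sides times `X - 1` equal `X ^ p - 1`. This expresses the trace through `(σ -
1) ^ (p - 1)` and a multiple of `p`. -/
theorem _root_.Polynomial.exists_geom_sum_eq_sub_one_pow_add {p : ℕ} (hp : p.Prime) :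
    ∃ Q : Polynomial ℤ, ∑ k ∈ Finset.range p, (Polynomial.X : Polynomial ℤ) ^ k =
      (Polynomial.X - 1) ^ (p - 1) + Polynomial.C (p : ℤ) * Q := by
  have : Fact p.Prime := ⟨hp⟩
  suffices Polynomial.C (p : ℤ) ∣
      ∑ k ∈ Finset.range p, (Polynomial.X : Polynomial ℤ) ^ k - (Polynomial.X - 1) ^ (p - 1) from
    this.imp fun Q hQ => by rw [← hQ]; ring
  rw [Polynomial.C_dvd_iff_dvd_coeff]
  intro i
  rw [← ZMod.intCast_zmod_eq_zero_iff_dvd, ← eq_intCast (Int.castRingHom (ZMod p)),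
    ← Polynomial.coeff_map]
  suffices Polynomial.map (Int.castRingHom (ZMod p))
      (∑ k ∈ Finset.range p, (Polynomial.X : Polynomial ℤ) ^ k - (Polynomial.X - 1) ^ (p - 1)) = 0
    by rw [this, Polynomial.coeff_zero]
  rw [Polynomial.map_sub, Polynomial.map_pow, Polynomial.map_sub, Polynomial.map_X,
    Polynomial.map_one, Polynomial.map_sum, sub_eq_zero]
  simp only [Polynomial.map_pow, Polynomial.map_X]
  have hX : (Polynomial.X - 1 : Polynomial (ZMod p)) ≠ 0 := by
    simpa using Polynomial.X_sub_C_ne_zero (1 : ZMod p)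
  refine mul_right_cancel₀ hX ?_
  rw [geom_sum_mul, ← pow_succ, Nat.sub_add_cancel hp.one_le, sub_pow_char, one_pow]

section Valuation

variable {R : Type*} [CommRing R] [IsDomain R] [IsDiscreteValuationRing R]

theorem irreducible_of_addVal_eq_one {x : R} (hx : addVal R x = 1) : Irreducible x := by
  obtain ⟨t, ht⟩ := exists_irreducible R
  rw [← addVal_uniformizer ht, addVal_eq_iff_associated] at hx
  exact hx.symm.irreducible ht

end Valuation

/-- The norm of `1 + y`, up to the norm of `y`, in terms of the trace form of a group `G` of
order `p`. -/
theorem prod_one_add_smul_eq {G S T : Type*} [Group G] [Fintype G] [CommRing S] [CommRing T]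
    [Algebra S T] [MulSemiringAction G T] [SMulCommClass G S T] [DecidableEq G] (u : ℕ → S)
    (hu : ∀ r, 0 < r → r < Fintype.card G → r * u r = 1) (y : T) :
    ∃ w, y ∣ w ∧ ∏ g : G, (1 + g • y) = 1 + ∏ g : G, g • y + ∑ g : G, g • w := by
  set P : Finset G → T := fun s => ∏ g ∈ s, g • y with hP
  -- Expand the product over subsets of `G`. A proper nonempty subset contributes its term once,
  -- split into equal shares among its elements by the inverse `u` of its size; `W` collects the
  -- shares of 1, and its translates collect the others.
  set W : T := ∑ s : Finset G, if 1 ∈ s ∧ s ≠ Finset.univ then u s.card • P s else 0 with hW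
  refine ⟨W, Finset.dvd_sum fun s _ => ?_, ?_⟩
  · split_ifs with hs
    · have h1 := Finset.dvd_prod_of_mem (fun g : G => g • y) hs.1
      rw [one_smul] at h1
      rw [Algebra.smul_def]
      exact dvd_mul_of_dvd_right h1 _
    · exact dvd_zero _
  have hg : ∀ g : G, g • W =
      ∑ s : Finset G, if g ∈ s ∧ s ≠ Finset.univ then u s.card • P s else 0 := by
    intro g
    rw [hW, Finset.smul_sum]
    refine Fintype.sum_equiv (Equiv.mulLeft g).finsetCongr _ _ fun s => ?_
    have h1 : g ∈ (Equiv.mulLeft g).finsetCongr s ↔ 1 ∈ s := by simp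
    have h2 : ¬((Equiv.mulLeft g).finsetCongr s = Finset.univ) ↔ ¬(s = Finset.univ) := by
      rw [not_iff_not, Equiv.finsetCongr_apply]
      nth_rw 1 [← Finset.map_univ_equiv (Equiv.mulLeft g)]
      rw [Finset.map_inj]
    simp only [ne_eq, h1, h2]
    split_ifs with hs
    · rw [smul_comm, Equiv.finsetCongr_apply, Finset.card_map, hP]
      simp only [Finset.smul_prod', smul_smul, Finset.prod_map]
      rfl
    · rw [smul_zero]
  simp_rw [hg]
  rw [Finset.sum_comm]
  have hs : ∀ s : Finset G,
      (∑ g : G, if g ∈ s ∧ s ≠ Finset.univ then u s.card • P s else 0) =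
        P s - (if s = ∅ then 1 else 0) - if s = Finset.univ then P Finset.univ else 0 := by
    intro s
    rcases eq_or_ne s Finset.univ with rfl | hs
    · simp [Finset.univ_nonempty.ne_empty]
    rcases eq_or_ne s ∅ with rfl | h0
    · simp [hP, Finset.univ_nonempty.ne_empty.symm]
    simp only [hs, h0, ne_eq, not_false_eq_true, and_true, if_false, sub_zero]
    rw [← Finset.sum_filter, Finset.filter_mem_eq_inter, Finset.univ_inter, Finset.sum_const,
      ← Nat.cast_smul_eq_nsmul S, smul_smul,
      hu _ (Finset.card_pos.2 (Finset.nonempty_iff_ne_empty.2 h0))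
        ((Finset.card_lt_iff_ne_univ s).2 hs), one_smul]
  simp_rw [hs, Finset.sum_sub_distrib, Finset.sum_ite_eq']
  rw [Finset.prod_one_add, Finset.powerset_univ]
  simp
  ring

variable {p m : ℕ} {S T : Type*} [CommRing S] [IsDomain S] [IsDiscreteValuationRing S]
  [CommRing T] [IsDomain T] [IsDiscreteValuationRing T]
  [Algebra S T] [Module.Finite S T] [FaithfulSMul S T] {σ : T ≃ₐ[S] T} {t : T}

namespace HasBreak

variable (h : HasBreak p m σ t)
include h

theorem congr_uniformizer {t₁ : T} (ht₁ : Irreducible t₁) : HasBreak p m σ t₁ where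
  __ := h
  irreducible := ht₁
  addVal_sub := by
    rw [h.addVal_sub_eq (n := 1) h.prime.not_dvd_one (by rw [addVal_uniformizer ht₁, Nat.cast_one]),
      add_comm]
  dvd_natCast := (associated_of_irreducible T ht₁ h.irreducible).dvd.trans h.dvd_natCast

theorem bijective_pow : Function.Bijective fun k : Fin p => σ ^ (k : ℕ) := by
  have := Fact.mk h.prime
  have hσ : orderOf σ = p := by
    refine orderOf_eq_prime h.pow_eq_one ?_
    rintro rfl
    have := h.addVal_sub
    rw [AlgEquiv.one_apply, sub_self, addVal_zero] at this
    exact ENat.natCast_ne_top _ this.symm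
  refine ⟨fun i j hij => Fin.ext ?_, fun g => ?_⟩
  · exact pow_injOn_Iio_orderOf (i.2.trans_eq hσ.symm) (j.2.trans_eq hσ.symm) hij
  · exact (h.exists_eq_pow g).elim fun k hk => ⟨⟨k, hk.1⟩, hk.2.symm⟩

theorem prod_range_pow {M : Type*} [CommMonoid M] [Fintype (T ≃ₐ[S] T)] (F : (T ≃ₐ[S] T) → M) :
    ∏ k ∈ Finset.range p, F (σ ^ k) = ∏ g, F g := by
  rw [Finset.prod_range]
  exact h.bijective_pow.prod_comp F

theorem sum_range_pow {M : Type*} [AddCommMonoid M] [Fintype (T ≃ₐ[S] T)]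
    (F : (T ≃ₐ[S] T) → M) : ∑ k ∈ Finset.range p, F (σ ^ k) = ∑ g, F g := by
  rw [Finset.sum_range]
  exact h.bijective_pow.sum_comp F

theorem card_eq [Fintype (T ≃ₐ[S] T)] : Fintype.card (T ≃ₐ[S] T) = p := by
  rw [← Fintype.card_of_bijective h.bijective_pow, Fintype.card_fin]

theorem addVal_natCast_eq_zero {r : ℕ} (h0 : 0 < r) (hr : r < p) : addVal S (r : S) = 0 := by
  have := h.addVal_algebraMap (r : S)
  rw [map_natCast, PurelyRamified.addVal_natCast_eq_zero h.irreducible h.prime h.dvd_natCast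
    (Nat.not_dvd_of_pos_of_lt h0 hr), eq_comm, mul_eq_zero] at this
  exact this.resolve_left (by exact_mod_cast h.prime.ne_zero)

/-- The norm is a product of `p` conjugates of equal valuation, and the ramification index `p`
cancels. -/
theorem addVal_norm (x : T) : addVal S (Algebra.norm S x) = addVal T x := by
  have := congrArg (addVal T) (h.norm_eq x)
  have hprod : ∀ k : ℕ, addVal T (∏ i ∈ Finset.range k, (σ ^ i) x) = k * addVal T x := by
    intro k
    induction k with
    | zero => simp
    | succ k ih =>
      rw [Finset.prod_range_succ, addVal_mul, ih, addVal_algEquiv]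
      push_cast
      ring
  rw [h.addVal_algebraMap, hprod] at this
  exact (ENat.mul_right_strictMono (by exact_mod_cast h.prime.ne_zero)
    (ENat.natCast_ne_top p)).injective this

section Trace

variable (hp : (((p - 1) * m : ℕ) : ℕ∞) ≤ addVal T (p : T))
include hp

theorem le_addVal_trace (w : T) :
    addVal T w + ((p - 1) * m : ℕ) ≤ addVal T (∑ k ∈ Finset.range p, (σ ^ k) w) := by
  obtain ⟨Q, hQ⟩ := Polynomial.exists_geom_sum_eq_sub_one_pow_add h.prime
  set φ : Module.End S T := σ.toLinearMap with hφ
  have hφ_pow : ∀ (k : ℕ) (x : T), (φ ^ k) x = (σ ^ k) x := by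
    intro k
    induction k with
    | zero => simp
    | succ k ih =>
      intro x
      rw [pow_succ, pow_succ, Module.End.mul_apply, AlgEquiv.mul_apply, ih]
      rfl
  have key := LinearMap.congr_fun (congrArg (Polynomial.aeval φ) hQ) w
  simp only [map_sum, map_pow, Polynomial.aeval_X, map_add, map_sub, map_one, map_mul,
    LinearMap.add_apply, LinearMap.sum_apply, hφ_pow] at key
  rw [key]
  refine le_addVal_add ?_ ?_
  · generalize p - 1 = n
    induction n with
    | zero => simp
    | succ n ih =>
      rw [pow_succ', Module.End.mul_apply, LinearMap.sub_apply, Module.End.one_apply]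
      refine le_trans ?_ (h.le_addVal_generator_sub _)
      rw [add_mul, one_mul, Nat.cast_add, ← add_assoc]
      gcongr
  · rw [Polynomial.aeval_C, Module.End.mul_apply, eq_intCast, Int.cast_natCast,
      Module.End.natCast_apply, nsmul_eq_mul, addVal_mul, add_comm]
    refine add_le_add hp ?_
    rw [Polynomial.aeval_eq_sum_range, LinearMap.sum_apply]
    refine AddValuation.map_le_sum _ fun k _ => ?_
    rw [LinearMap.smul_apply, hφ_pow, zsmul_eq_mul, addVal_mul, addVal_algEquiv]
    exact le_add_self

/-- The difference is a trace of a multiple of `y`, so `p` times its `S`-valuation is at least `n +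
(p - 1) * m`. As `n < m`, this exceeds `p * n`. -/
theorem le_addVal_norm_one_add_sub {n : ℕ} (hn : n < m) {y : T} (hy : (n : ℕ∞) ≤ addVal T y) :
    ((n + 1 : ℕ) : ℕ∞) ≤ addVal S (Algebra.norm S (1 + y) - (1 + Algebra.norm S y)) := by
  classical
  have : Finite (T ≃ₐ[S] T) := Finite.of_surjective _ h.bijective_pow.surjective
  have := Fintype.ofFinite (T ≃ₐ[S] T)
  have hu : ∀ r : ℕ, ∃ u : S, 0 < r → r < Fintype.card (T ≃ₐ[S] T) → r * u = 1 := by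
    intro r
    by_cases hr : 0 < r ∧ r < p
    · obtain ⟨u, hu⟩ := (addVal_eq_zero_iff.1 (h.addVal_natCast_eq_zero hr.1 hr.2)).exists_right_inv
      exact ⟨u, fun _ _ => hu⟩
    · exact ⟨0, fun h0 h1 => absurd ⟨h0, h.card_eq ▸ h1⟩ hr⟩
  choose u hu using hu
  obtain ⟨w, hyw, hw⟩ := prod_one_add_smul_eq (G := T ≃ₐ[S] T) u hu y
  have hnorm : algebraMap S T (Algebra.norm S (1 + y) - (1 + Algebra.norm S y)) =
      ∑ k ∈ Finset.range p, (σ ^ k) w := by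
    rw [map_sub, map_add (algebraMap S T), map_one, h.norm_eq, h.norm_eq, h.prod_range_pow fun g => g (1 + y),
      h.prod_range_pow fun g => g y, h.sum_range_pow fun g => g w]
    simp only [AlgEquiv.smul_def] at hw
    simp only [map_add, map_one, hw]
    ring
  have hval := h.le_addVal_trace hp w
  rw [← hnorm, h.addVal_algebraMap] at hval
  have hnw : (n : ℕ∞) ≤ addVal T w := hy.trans (addVal_le_iff_dvd.2 hyw)
  rcases eq_or_ne (addVal S (Algebra.norm S (1 + y) - (1 + Algebra.norm S y))) ⊤ with hc | hc
  · rw [hc]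
    exact le_top
  obtain ⟨c, hc⟩ := ENat.ne_top_iff_exists.1 hc
  rw [← hc] at hval ⊢
  replace hval := (add_le_add_left hnw _).trans hval
  norm_cast at hval ⊢
  by_contra! hcn
  obtain ⟨q, rfl⟩ : ∃ q, p = q + 1 := ⟨p - 1, (Nat.sub_add_cancel h.prime.one_le).symm⟩
  have hq := h.prime.two_le
  rw [Nat.add_sub_cancel] at hval
  have h1 : (q + 1) * c ≤ (q + 1) * n := Nat.mul_le_mul_left _ (by omega)
  have h2 : q * (n + 1) ≤ q * m := Nat.mul_le_mul_left _ hn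
  rw [add_mul] at h1
  rw [mul_add] at h2
  rw [add_mul] at hval h1
  omega

/-- If the residue field is perfect, norms of uniformizers approximate any uniformizer. -/
theorem exists_norm_approx (hperf : ∀ a : S, ∃ b : S, 1 ≤ addVal S (b ^ p - a)) {s : S}
    (hs : Irreducible s) {n : ℕ} (hn : 1 ≤ n) (hnm : n ≤ m) :
    ∃ x : T, Irreducible x ∧ ((n + 1 : ℕ) : ℕ∞) ≤ addVal S (Algebra.norm S x - s) := by
  have hsmul : ∀ (b : S) (x : T), Algebra.norm S (b • x) = b ^ p * Algebra.norm S x := by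
    intro b x
    rw [Algebra.smul_def, map_mul, Algebra.norm_algebraMap, h.finrank_eq]
  suffices ∃ x : T, ((n + 1 : ℕ) : ℕ∞) ≤ addVal S (Algebra.norm S x - s) by
    obtain ⟨x, hx⟩ := this
    refine ⟨x, irreducible_of_addVal_eq_one ?_, hx⟩
    have hlt : addVal S s < addVal S (Algebra.norm S x - s) := by
      rw [addVal_uniformizer hs]
      refine lt_of_lt_of_le ?_ hx
      exact_mod_cast Nat.lt_succ_of_le hn
    rw [← h.addVal_norm, ← addVal_uniformizer hs, ← AddValuation.map_add_eq_of_lt_left _ hlt,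
      add_sub_cancel]
  induction n, hn using Nat.le_induction with
  | base =>
    have hN : addVal S (Algebra.norm S t) = 1 := by
      rw [h.addVal_norm, addVal_uniformizer h.irreducible]
    obtain ⟨ε, hε⟩ : Algebra.norm S t ∣ s := by
      rw [← addVal_le_iff_dvd, hN, addVal_uniformizer hs]
    obtain ⟨b, hb⟩ := hperf ε
    refine ⟨b • t, ?_⟩
    rw [hsmul, show b ^ p * Algebra.norm S t - s = Algebra.norm S t * (b ^ p - ε) by
      rw [hε]; ring, addVal_mul, hN]
    exact add_le_add le_rfl hb
  | succ n hn ih =>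
    obtain ⟨x, hx⟩ := ih (by omega)
    have hN : addVal S (Algebra.norm S x) = 1 := by
      have hlt : addVal S s < addVal S (Algebra.norm S x - s) := by
        rw [addVal_uniformizer hs]
        refine lt_of_lt_of_le ?_ hx
        exact_mod_cast Nat.lt_succ_of_le hn
      rw [← addVal_uniformizer hs, ← AddValuation.map_add_eq_of_lt_left _ hlt, add_sub_cancel]
    set N := Algebra.norm S x with hNx
    obtain ⟨a, ha⟩ : N ^ (n + 1) ∣ s - N := by
      rw [← addVal_le_iff_dvd, (irreducible_of_addVal_eq_one hN).addVal_pow,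
        AddValuation.map_sub_swap]
      exact hx
    obtain ⟨b, hb⟩ := hperf a
    have hy : (n : ℕ∞) ≤ addVal T (b • x ^ n) := by
      rw [Algebra.smul_def, addVal_mul, addVal_pow, ← h.addVal_norm x, ← hNx, hN]
      simp
    have he := h.le_addVal_norm_one_add_sub hp (by omega : n < m) hy
    rw [hsmul, map_pow, ← hNx] at he
    -- The norm of the new factor is approximately `1 + b ^ p * N ^ n`, and `b` is a `p`-th root
    -- modulo `s` of the leading coefficient `a` of the error.
    refine ⟨x * (1 + b • x ^ n), ?_⟩
    rw [map_mul, ← hNx,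
      show N * Algebra.norm S (1 + b • x ^ n) - s = N ^ (n + 1) * (b ^ p - a) +
        N * (Algebra.norm S (1 + b • x ^ n) - (1 + b ^ p * N ^ n)) by
          rw [mul_sub (N ^ (n + 1)), ← ha]; ring]
    refine le_addVal_add ?_ ?_
    · rw [addVal_mul, addVal_pow, hN, nsmul_eq_mul, mul_one, Nat.cast_succ (n + 1)]
      gcongr
    · rw [addVal_mul, hN, Nat.cast_succ (n + 1), add_comm]
      gcongr

end Trace

end HasBreak

end PurelyRamified

/-! ### The discriminant in terms of the break, and existence of the break. -/

namespace PurelyRamified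

variable {p m : ℕ} {S T : Type*} [CommRing S] [IsDomain S] [IsDiscreteValuationRing S]
  [CommRing T] [IsDomain T] [IsDiscreteValuationRing T]
  [Algebra S T] [Module.Finite S T] [FaithfulSMul S T] {σ : T ≃ₐ[S] T} {t : T}

theorem natDegree_minpoly_le_finrank (x : T) :
    (minpoly S x).natDegree ≤ Module.finrank S T := by
  rw [← LinearMap.charpoly_natDegree (Algebra.lmul S T x)]
  refine Polynomial.natDegree_le_natDegree (minpoly.min S x (LinearMap.charpoly_monic _) ?_)
  have := LinearMap.aeval_self_charpoly (Algebra.lmul S T x)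
  rw [Polynomial.aeval_algHom_apply] at this
  simpa using LinearMap.congr_fun this 1

namespace HasBreak

variable (h : HasBreak p m σ t)
include h

theorem pow_injOn : Set.InjOn (fun k : ℕ => (σ ^ k) t) (Finset.range p) := by
  intro i hi j hj hij
  rw [Finset.coe_range, Set.mem_Iio] at hi hj
  have hext : σ ^ i = σ ^ j := AlgEquiv.coe_toAlgHom_injective <|
    AlgHom.ext_of_adjoin_eq_top (h.adjoin_eq_top h.irreducible) fun x hx => by
      rw [Set.mem_singleton_iff.1 hx]; exact hij
  exact congrArg Fin.val (h.bijective_pow.injective (a₁ := ⟨i, hi⟩) (a₂ := ⟨j, hj⟩) hext)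

/-- The `p` conjugates of `t` are distinct roots, and the degree is at most the rank `p`. -/
theorem map_minpoly : (minpoly S t).map (algebraMap S T) =
    ∏ k ∈ Finset.range p, (Polynomial.X - Polynomial.C ((σ ^ k) t)) := by
  classical
  have hmonic := minpoly.monic (Algebra.IsIntegral.isIntegral (R := S) t)
  refine Polynomial.eq_of_monic_of_dvd_of_natDegree_le
    (Polynomial.monic_prod_X_sub_C (fun k => (σ ^ k) t) _)
    (hmonic.map _) ?_ ?_
  · have := (Multiset.prod_X_sub_C_dvd_iff_le_roots (hmonic.map (algebraMap S T)).ne_zero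
      (((Finset.range p).image fun k => (σ ^ k) t).val)).2 ?_
    · change (∏ a ∈ (Finset.range p).image fun k => (σ ^ k) t,
        (Polynomial.X - Polynomial.C a)) ∣ _ at this
      rwa [Finset.prod_image h.pow_injOn] at this
    · rw [Finset.val_le_iff_val_subset]
      intro x hx
      obtain ⟨k, -, rfl⟩ := Finset.mem_image.1
        (show x ∈ (Finset.range p).image fun k => (σ ^ k) t from hx)
      rw [Polynomial.mem_roots (hmonic.map _).ne_zero, Polynomial.IsRoot,
        Polynomial.eval_map_algebraMap]
      refine (Polynomial.aeval_algHom_apply (σ ^ k).toAlgHom t _).trans ?_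
      rw [minpoly.aeval, map_zero]
  · rw [Polynomial.natDegree_finsetProd_X_sub_C_eq_card, hmonic.natDegree_map, Finset.card_range]
    exact (natDegree_minpoly_le_finrank t).trans_eq h.finrank_eq

theorem addVal_aeval_derivative_minpoly :
    addVal T (Polynomial.aeval t (Polynomial.derivative (minpoly S t))) =
      ((p - 1) * (m + 1) : ℕ) := by
  obtain ⟨q, rfl⟩ : ∃ q, p = q + 1 := ⟨p - 1, (Nat.sub_add_cancel h.prime.one_le).symm⟩
  rw [← Polynomial.eval_map_algebraMap, ← Polynomial.derivative_map, h.map_minpoly,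
    Finset.prod_range_succ', pow_zero, AlgEquiv.one_apply, Polynomial.derivative_mul,
    Polynomial.eval_add, Polynomial.eval_mul, Polynomial.eval_mul, Polynomial.derivative_X_sub_C,
    Polynomial.eval_sub, Polynomial.eval_X, Polynomial.eval_C, sub_self, mul_zero, zero_add,
    Polynomial.eval_one, mul_one, Polynomial.eval_prod, Nat.add_sub_cancel]
  simp only [Polynomial.eval_sub, Polynomial.eval_X, Polynomial.eval_C]
  have : ∀ k ≤ q, addVal T (∏ j ∈ Finset.range k, (t - (σ ^ (j + 1)) t)) =
      (k * (m + 1) : ℕ) := by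
    intro k
    induction k with
    | zero => simp
    | succ k ih =>
      intro hk
      rw [Finset.prod_range_succ, addVal_mul, ih (by omega), AddValuation.map_sub_swap,
        h.addVal_pow_sub_self (Nat.not_dvd_of_pos_of_lt (by omega) (by omega)), add_mul, one_mul]
      norm_cast
  exact this q le_rfl

attribute [local instance] FractionRing.liftAlgebra in
-- Since `T = S[t]`, the different is generated by the derivative of the minimal polynomial at `t`,
-- a product of `p - 1` factors of valuation `m + 1`; the norm preserves valuations.
theorem discriminantVal_eq (hgal : IsGalois (FractionRing S) (FractionRing T)) :
    discriminantVal S T = ((p - 1) * (m + 1) : ℕ) := by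
  have : FiniteDimensional (FractionRing S) (FractionRing T) :=
    .of_isLocalization S T (nonZeroDivisors S)
  have hadj : Algebra.adjoin (FractionRing S) {algebraMap T (FractionRing T) t} = ⊤ := by
    rw [← IntermediateField.adjoin_simple_toSubalgebra_of_isAlgebraic
      (Algebra.IsAlgebraic.isAlgebraic _), ← IntermediateField.top_toSubalgebra]
    congr 1
    rw [eq_top_iff]
    intro y _
    have hmem : ∀ x : T, algebraMap T (FractionRing T) x ∈
        IntermediateField.adjoin (FractionRing S) {algebraMap T (FractionRing T) t} := by
      intro x
      have hx : x ∈ Algebra.adjoin S {t} := h.adjoin_eq_top h.irreducible ▸ Algebra.mem_top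
      induction hx using Algebra.adjoin_induction with
      | mem x hx =>
        rw [Set.mem_singleton_iff.1 hx]
        exact IntermediateField.mem_adjoin_simple_self _ _
      | algebraMap c =>
        rw [← IsScalarTower.algebraMap_apply,
          IsScalarTower.algebraMap_apply S (FractionRing S) (FractionRing T)]
        exact IntermediateField.algebraMap_mem _ _
      | add x y _ _ hx hy => rw [map_add]; exact add_mem hx hy
      | mul x y _ _ hx hy => rw [map_mul]; exact mul_mem hx hy
    obtain ⟨a, b, -, rfl⟩ := IsFractionRing.div_surjective T y
    exact div_mem (hmem a) (hmem b)
  have hdiff := conductor_mul_differentIdeal S (FractionRing S) (FractionRing T) t hadj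
  rw [conductor_eq_top_of_adjoin_eq_top (h.adjoin_eq_top h.irreducible), Ideal.top_mul] at hdiff
  obtain ⟨s, hs⟩ := exists_irreducible S
  have hval := h.addVal_aeval_derivative_minpoly
  rw [← h.addVal_norm, ← hs.addVal_pow, addVal_eq_iff_associated] at hval
  rw [discriminantVal, discriminant, hdiff, Ideal.relNorm_singleton, Algebra.intNorm_eq_norm,
    Ideal.span_singleton_eq_span_singleton.2 hval, ← Ideal.span_singleton_pow,
    ← hs.maximalIdeal_eq]
  exact emultiplicity_pow_self (not_a_field S)
    (mt Ideal.isUnit_iff.1 (maximalIdeal.isMaximal S).ne_top) _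

end HasBreak

attribute [local instance] FractionRing.liftAlgebra in
theorem IsPurelyRamifiedCyclic.isTotallyRamified (hp : p.Prime)
    (hT : IsPurelyRamifiedCyclic p S T) : IsTotallyRamified p S T := by
  have := hT.isGalois
  have : FiniteDimensional (FractionRing S) (FractionRing T) :=
    .of_isLocalization S T (nonZeroDivisors S)
  have hfin : Module.finrank S T = p := by
    rw [← IsFractionRing.finrank_eq S (FractionRing S) T (FractionRing T),
      ← IsGalois.card_aut_eq_finrank, Nat.card_congr hT.gal_equiv.some.toEquiv,
      Nat.card_congr Multiplicative.toAdd, Nat.card_zmod]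
  refine ⟨hp.ne_zero, fun c => ?_, hfin⟩
  obtain ⟨s, hs⟩ := exists_irreducible S
  obtain ⟨t, ht⟩ := exists_irreducible T
  have hst : addVal T (algebraMap S T s) = p := by
    have := hT.map_maximalIdeal
    rw [hs.maximalIdeal_eq, ht.maximalIdeal_eq, Ideal.map_span, Set.image_singleton, hfin,
      Ideal.span_singleton_pow, Ideal.span_singleton_eq_span_singleton,
      ← addVal_eq_iff_associated, ht.addVal_pow] at this
    exact this
  rcases eq_or_ne c 0 with rfl | hc
  · rw [map_zero, addVal_zero, addVal_zero, ENat.mul_top (by exact_mod_cast hp.ne_zero)]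
  obtain ⟨n, u, rfl⟩ := eq_unit_mul_pow_irreducible hc hs
  rw [map_mul, map_pow, addVal_mul, addVal_pow, hst, addVal_def' u hs,
    addVal_eq_zero_iff.2 (u.isUnit.map (algebraMap S T)), zero_add, nsmul_eq_mul, mul_comm]

/-- Ramification is wild: `σ t` is `c * t` modulo `t ^ 2`, so `σ ^ p = 1` forces `c ^ p` to be 1 in
the residue field, hence `c` too in characteristic `p`. -/
theorem IsTotallyRamified.two_le_addVal_sub (hp : p.Prime) [CharP (ResidueField S) p]
    (h : IsTotallyRamified p S T) (hσ : σ ^ p = 1) (ht : Irreducible t) :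
    2 ≤ addVal T (σ t - t) := by
  obtain ⟨ω, hω⟩ : t ∣ σ t := by rw [← addVal_le_iff_dvd, addVal_algEquiv]
  obtain ⟨c, y, rfl⟩ := h.exists_eq_algebraMap_add ht ω
  have ht1 := addVal_uniformizer ht
  have h1 : 2 ≤ addVal T (σ t - algebraMap S T c * t) := by
    rw [hω, show t * (algebraMap S T c + t * y) - algebraMap S T c * t = t ^ 2 * y by ring,
      addVal_mul, ht.addVal_pow]
    exact le_self_add
  have h2 : ∀ k : ℕ, 2 ≤ addVal T ((σ ^ k) t - algebraMap S T (c ^ k) * t) := by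
    intro k
    induction k with
    | zero => simp
    | succ k ih =>
      rw [pow_succ', AlgEquiv.mul_apply,
        show σ ((σ ^ k) t) - algebraMap S T (c ^ (k + 1)) * t =
          σ ((σ ^ k) t - algebraMap S T (c ^ k) * t) +
            algebraMap S T (c ^ k) * (σ t - algebraMap S T c * t) by
          rw [map_sub, map_mul, AlgEquiv.commutes, pow_succ, map_mul]; ring]
      refine le_addVal_add (by rwa [addVal_algEquiv]) ?_
      rw [addVal_mul]
      exact h1.trans le_add_self
  have h3 := h2 p
  rw [hσ, AlgEquiv.one_apply, show t - algebraMap S T (c ^ p) * t =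
    algebraMap S T (1 - c ^ p) * t by rw [map_sub, map_one]; ring, addVal_mul, ht1,
    h.addVal_algebraMap] at h3
  have h4 : 1 - c ^ p ∈ maximalIdeal S := by
    rw [mem_maximalIdeal, mem_nonunits_iff, ← addVal_eq_zero_iff]
    intro h0
    rw [h0, mul_zero, zero_add] at h3
    exact absurd h3 (by decide)
  have h5 : c - 1 ∈ maximalIdeal S := by
    have := Fact.mk hp
    rw [← residue_eq_zero_iff] at h4 ⊢
    rw [map_sub, map_pow, map_one, sub_eq_zero] at h4
    refine eq_zero_of_pow_eq_zero (n := p) ?_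
    rw [map_sub, map_one, sub_pow_char, one_pow, ← h4, sub_self]
  have h6 : 1 ≤ addVal S (c - 1) := by
    rw [Order.one_le_iff_ne_zero, ne_eq, addVal_eq_zero_iff]
    exact (mem_maximalIdeal _).1 h5
  rw [show σ t - t = (σ t - algebraMap S T c * t) + algebraMap S T (c - 1) * t by
    rw [map_sub, map_one]; ring]
  refine le_addVal_add h1 ?_
  rw [addVal_mul, ht1, h.addVal_algebraMap]
  calc (2 : ℕ∞) = 1 * 1 + 1 := by norm_num
    _ ≤ _ := by
      gcongr
      exact_mod_cast hp.one_le

attribute [local instance] FractionRing.liftAlgebra in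
/-- A purely ramified cyclic extension of degree `p` has a ramification break. -/
theorem IsPurelyRamifiedCyclic.exists_hasBreak (hp : p.Prime) [CharP (ResidueField S) p]
    (hT : IsPurelyRamifiedCyclic p S T) :
    ∃ (σ : T ≃ₐ[S] T) (t : T) (m : ℕ), HasBreak p m σ t := by
  have h := hT.isTotallyRamified hp
  have := hT.isGalois
  have : FiniteDimensional (FractionRing S) (FractionRing T) :=
    .of_isLocalization S T (nonZeroDivisors S)
  let e : (T ≃ₐ[S] T) ≃* Multiplicative (ZMod p) :=
    (galRestrict S (FractionRing S) (FractionRing T) T).symm.trans hT.gal_equiv.some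
  have := Fact.mk hp
  have hcard : Nat.card (T ≃ₐ[S] T) = p := by
    rw [Nat.card_congr e.toEquiv, Nat.card_congr Multiplicative.toAdd, Nat.card_zmod]
  have : Finite (T ≃ₐ[S] T) := Finite.of_equiv _ e.symm.toEquiv
  have : IsCyclic (T ≃ₐ[S] T) := isCyclic_of_prime_card hcard
  obtain ⟨σ, hσ⟩ := IsCyclic.exists_generator (α := T ≃ₐ[S] T)
  have hord : orderOf σ = p := by rw [orderOf_eq_card_of_forall_mem_zpowers hσ, hcard]
  obtain ⟨t, ht⟩ := exists_irreducible T
  have hpow : σ ^ p = 1 := hord ▸ pow_orderOf_eq_one σ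
  have hgen : ∀ g : T ≃ₐ[S] T, ∃ k < p, g = σ ^ k := by
    classical
    intro g
    have hg := hσ g
    rw [← mem_powers_iff_mem_zpowers, mem_powers_iff_mem_range_orderOf, hord,
      Finset.mem_image] at hg
    obtain ⟨k, hk, rfl⟩ := hg
    exact ⟨k, Finset.mem_range.1 hk, rfl⟩
  have hbij : Function.Bijective fun k : Fin p => σ ^ (k : ℕ) :=
    ⟨fun i j hij => Fin.ext (pow_injOn_Iio_orderOf (i.2.trans_eq hord.symm)
      (j.2.trans_eq hord.symm) hij),
      fun g => (hgen g).elim fun k hk => ⟨⟨k, hk.1⟩, hk.2.symm⟩⟩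
  have hne : addVal T (σ t - t) ≠ ⊤ := by
    rw [ne_eq, addVal_eq_top_iff, sub_eq_zero]
    intro h0
    have h1 : σ = 1 := AlgEquiv.coe_toAlgHom_injective <|
      AlgHom.ext_of_adjoin_eq_top (h.adjoin_eq_top ht) fun x hx => by
        rw [Set.mem_singleton_iff.1 hx]; exact h0
    rw [h1, orderOf_one] at hord
    exact hp.one_lt.ne hord
  obtain ⟨n, hn⟩ := ENat.ne_top_iff_exists.1 hne
  have h2 := h.two_le_addVal_sub hp hpow ht
  rw [← hn] at h2
  have h2' : 2 ≤ n := by exact_mod_cast h2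
  refine ⟨σ, t, n - 1, { h with
    prime := hp
    irreducible := ht
    break_pos := by omega
    exists_eq_pow := hgen
    pow_eq_one := hpow
    addVal_sub := by rw [← hn, Nat.sub_add_cancel (by omega)]
    dvd_natCast := ?_
    norm_eq := fun x => ?_ }⟩
  · rw [← addVal_le_iff_dvd, addVal_uniformizer ht, ← map_natCast (algebraMap S T),
      h.addVal_algebraMap]
    calc (1 : ℕ∞) = 1 * 1 := by norm_num
      _ ≤ _ := by
        gcongr
        · exact_mod_cast hp.one_le
        · rw [Order.one_le_iff_ne_zero, ne_eq, addVal_eq_zero_iff, ← mem_nonunits_iff,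
            ← mem_maximalIdeal, ← residue_eq_zero_iff, map_natCast, CharP.cast_eq_zero]
  · rw [← Algebra.intNorm_eq_norm, Algebra.algebraMap_intNorm_of_isGalois, Finset.prod_range]
    exact (hbij.prod_comp fun g => g x).symm

end PurelyRamified

/-! ### The main theorem. -/

theorem mainTheorem10
    (p : ℕ) (hp : p.Prime) (hp3 : 3 ≤ p)
    (S : Type*) [CommRing S] [IsDomain S] [IsDiscreteValuationRing S]
    [CharP (IsLocalRing.ResidueField S) p]
    (T : Type*) [CommRing T] [IsDomain T] [IsDiscreteValuationRing T]
    [Algebra S T] [Module.Finite S T] [FaithfulSMul S T]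
    (T' : Type*) [CommRing T'] [IsDomain T'] [IsDiscreteValuationRing T']
    [Algebra S T'] [Module.Finite S T'] [FaithfulSMul S T']
    (hT : PurelyRamified.IsPurelyRamifiedCyclic p S T)
    (hT' : PurelyRamified.IsPurelyRamifiedCyclic p S T')
    (hS : PerfectField (IsLocalRing.ResidueField S) ∨
      ∃ (t : T) (t' : T'), Irreducible t ∧ Irreducible t' ∧
        Algebra.norm S t = Algebra.norm S t')
    (hdisc : PurelyRamified.discriminantVal S T = PurelyRamified.discriminantVal S T')
    (hle : PurelyRamified.discriminantVal S T ≤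
      (p : ℕ∞) * IsDiscreteValuationRing.addVal S (p : S) + ((p - 1 : ℕ) : ℕ∞)) :
    Nonempty (PurelyRamified.TwistedGroupRing S T ≃ₐ[S]
      PurelyRamified.TwistedGroupRing S T') := by
  obtain ⟨σ, t, m, h⟩ := hT.exists_hasBreak hp
  obtain ⟨σ', t', m', h'⟩ := hT'.exists_hasBreak hp
  rw [h.discriminantVal_eq hT.isGalois] at hdisc hle
  rw [h'.discriminantVal_eq hT'.isGalois, ENat.natCast_inj] at hdisc
  obtain rfl : m = m' := Nat.succ_injective
    (Nat.eq_of_mul_eq_mul_left (Nat.sub_pos_of_lt hp.one_lt) hdisc)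
  rcases hS with hS | ⟨x, x', hx, hx', hN⟩
  -- Cancelling `p - 1` from the bound on the discriminant leaves exactly this.
  · have hpm : (((p - 1) * m : ℕ) : ℕ∞) ≤ IsDiscreteValuationRing.addVal T (p : T) := by
      rw [← map_natCast (algebraMap S T), h.addVal_algebraMap]
      rw [mul_add, mul_one, Nat.cast_add] at hle
      exact (ENat.add_le_add_iff_right (ENat.natCast_ne_top _)).1 hle
    have hperf : ∀ a : S, ∃ b : S, 1 ≤ IsDiscreteValuationRing.addVal S (b ^ p - a) := by
      intro a
      have := Fact.mk hp
      have := PerfectField.toPerfectRing (K := ResidueField S) p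
      obtain ⟨β, hβ⟩ := surjective_frobenius (ResidueField S) p (residue S a)
      obtain ⟨b, rfl⟩ := residue_surjective β
      refine ⟨b, ?_⟩
      rw [Order.one_le_iff_ne_zero, ne_eq, IsDiscreteValuationRing.addVal_eq_zero_iff,
        ← mem_nonunits_iff, ← mem_maximalIdeal, ← residue_eq_zero_iff, map_sub, map_pow, ← hβ,
        frobenius_def, sub_self]
    -- The norm of `t'` is the uniformizer of `S` to be approximated, up to the full precision `m +
    -- 1`, by norms from `T`.
    have hs : Irreducible (Algebra.norm S t') :=
      PurelyRamified.irreducible_of_addVal_eq_one <| by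
        rw [h'.addVal_norm, IsDiscreteValuationRing.addVal_uniformizer h'.irreducible]
    obtain ⟨x, hx, hN⟩ := h.exists_norm_approx hpm hperf hs h.break_pos le_rfl
    exact (h.congr_uniformizer hx).nonempty_algEquiv h' hN
  · refine (h.congr_uniformizer hx).nonempty_algEquiv (h'.congr_uniformizer hx') ?_
    rw [hN, sub_self, IsDiscreteValuationRing.addVal_zero]
    exact le_top
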